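/- For a graph $X=(V,E)$ let $\mathrm{List}(X)$, the list-chromatic number of $X$, be the least (finite or infinite) cardinal $\kappa$ such that for every function $F$ assigning to each vertex a set of ordinals of cardinality $\kappa$ there is a coloring $f$ of the vertices by ordinals such that $f(x)\in F(x)$ for all $x\in V$ and $f(x)\neq f(y)$ whenever $x,y$ are adjacent. Let $\mathrm{Refl}(\mathrm{List})$ be the assertion that every graph $X$ with $\mathrm{List}(X)>\omega$ has a subgraph $Y$ with exactly $\omega_1$ vertices and $\mathrm{List}(Y)>\omega$. Let $\mathrm{Cof}(\omega)$ be the class of ordinals of cofinality $\omega$. A stationary set $S\subseteq\kappa$, where $\kappa$ is regular uncountable, is reflecting if there is $\alpha<\kappa$ of uncountable cofinality such that $S\cap\alpha$ is stationary in $\alpha$. Proposition. Suppose $\mathrm{Refl}(\mathrm{List})$ holds. Then for every cardinal $\lambda\ge\omega_1$ of uncountable cofinality, either $2^\lambda>\lambda^+$, or every stationary subset of $\lambda^+\cap\mathrm{Cof}(\omega)$ is reflecting. -/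

import Mathlib

open Cardinal Ordinal

universe u

/-- The list-chromatic number of a graph: the least cardinal `κ`, finite or infinite, such that
whenever every vertex `v` is given a list `F v` of exactly `κ` ordinals, there is a good coloring
(adjacent vertices get different ordinals) picking the color of each vertex from its list. -/
noncomputable def SimpleGraph.listChromaticNumber {V : Type u} (G : SimpleGraph V) : Cardinal.{u} :=
  sInf {κ : Cardinal.{u} | ∀ F : V → Set Ordinal.{u},
    (∀ v, #(F v) = Cardinal.lift.{u + 1} κ) → ∃ f : G.Coloring Ordinal.{u}, ∀ v, f v ∈ F v}

/-- `Refl(List, μ)`: every graph with at most `μ` vertices and uncountable list-chromatic number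
has a subgraph with exactly `ℵ₁` vertices and uncountable list-chromatic number. -/
def ListReflectionAt (μ : Cardinal.{u}) : Prop :=
  ∀ (V : Type u) (G : SimpleGraph V), #V ≤ μ → ℵ₀ < G.listChromaticNumber →
    ∃ Y : G.Subgraph, #Y.verts = ℵ₁ ∧ ℵ₀ < Y.coe.listChromaticNumber

/-- `Refl(List)`: the principle `Refl(List, μ)` holds for every infinite cardinal `μ`. -/
def ListReflection : Prop :=
  ∀ μ : Cardinal.{u}, ℵ₀ ≤ μ → ListReflectionAt μ

/-- `S ∩ o` is stationary in the ordinal `o`: it meets every closed unbounded subset of `o`.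
Only used for `o` of uncountable cofinality. -/
def IsStationaryIn (S : Set Ordinal.{u}) (o : Ordinal.{u}) : Prop :=
  IsStationary {x : Set.Iio o | (x : Ordinal.{u}) ∈ S}

/-- `S` reflects below `o`: for some `α < o`, necessarily a limit ordinal of uncountable
cofinality, `S ∩ α` is stationary in `α`. -/
def ReflectsBelow (S : Set Ordinal.{u}) (o : Ordinal.{u}) : Prop :=
  ∃ α < o, ℵ₀ < α.cof ∧ IsStationaryIn S α

/-! Suppose `2 ^ μ ≤ μ⁺` and some stationary `S ⊆ μ⁺ ∩ Cof(ω)` does not reflect. Join each `δ ∈ S`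
to a ladder of successor ordinals converging to `δ`; this graph violates `ListReflection`. Globally,
the cardinal arithmetic gives a guessing sequence on `S` (`exists_guessing_sequence`), and lists
built from the guesses defeat every coloring (`not_isListColorable_ladderGraph`). Locally,
non-reflection makes the ladders below any `γ < μ⁺` disjoint up to initial segments
(`exists_disjoint_tails`). A subgraph with at most `μ` vertices is bounded, so it can be ranked with
finitely many smaller neighbors at each vertex, and greedy coloring works.

Guessing is proved by contradiction. For each `i < μ`, recursion yields functions each evading the
guess read off from codes that agree with all earlier ones. At a suitable `δ ∈ S`, since `cof μ >
ω`, a single piece of fewer than `μ` codes contains correct codes on cofinally many initial segments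
of `δ`; yet each of `μ` stages eliminates a new code from that piece. -/

namespace SimpleGraph

/-! ### List colorings and greedy coloring. -/

variable {V : Type u} {G : SimpleGraph V}

/-- A graph is `κ`-list-colorable if it can be colored from any lists of exactly `κ` ordinals. -/
def IsListColorable (G : SimpleGraph V) (κ : Cardinal.{u}) : Prop :=
  ∀ F : V → Set Ordinal.{u}, (∀ v, #(F v) = Cardinal.lift.{u + 1} κ) →
    ∃ f : G.Coloring Ordinal.{u}, ∀ v, f v ∈ F v

theorem IsListColorable.mono {κ κ' : Cardinal.{u}} (hG : G.IsListColorable κ) (h : κ ≤ κ') :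
    G.IsListColorable κ' := by
  intro F hF
  have hsub : ∀ v, ∃ p ⊆ F v, #p = Cardinal.lift.{u + 1} κ := fun v ↦
    Cardinal.le_mk_iff_exists_subset.1 (by rw [hF v]; exact Cardinal.lift_le.2 h)
  choose F' hF' hcard using hsub
  obtain ⟨f, hf⟩ := hG F' hcard
  exact ⟨f, fun v ↦ hF' v (hf v)⟩

/-- If the edges of a graph are oriented along a well-founded order so that every vertex has fewer
than `κ` smaller neighbors, then a greedy choice of colors shows that it is `κ`-list-colorable. -/
theorem isListColorable_of_rank {W : Type*} [Preorder W] [WellFoundedLT W] (r : V → W)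
    {κ : Cardinal.{u}} (hr : ∀ u v, G.Adj u v → r u < r v ∨ r v < r u)
    (hκ : ∀ v, #{u // G.Adj u v ∧ r u < r v} < κ) : G.IsListColorable κ := by
  intro F hF
  have hex : ∀ (v : V) (g : ∀ u, r u < r v → Ordinal.{u}),
      ∃ c ∈ F v, ∀ u (_ : G.Adj u v) (h : r u < r v), g u h ≠ c := by
    intro v g
    by_contra! hcon
    have hsub : F v ⊆ Set.range fun u : {u // G.Adj u v ∧ r u < r v} ↦ g u.1 u.2.2 := by
      intro c hc
      obtain ⟨u, h₁, h₂, h₃⟩ := hcon c hc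
      exact ⟨⟨u, h₁, h₂⟩, h₃⟩
    have hle := Cardinal.mk_le_mk_of_subset hsub
    rw [hF v] at hle
    have hrange := Cardinal.mk_range_le_lift
      (f := fun u : {u // G.Adj u v ∧ r u < r v} ↦ g u.1 u.2.2)
    rw [Cardinal.lift_id'.{u, u + 1}] at hrange
    exact (hle.trans hrange).not_gt (Cardinal.lift_lt.2 (hκ v))
  choose c hc hne using hex
  have hwf : WellFounded (InvImage (· < ·) r) := InvImage.wf r wellFounded_lt
  let f : V → Ordinal.{u} := hwf.fix c
  have hf : ∀ v, f v = c v fun u _ ↦ f u := fun v ↦ hwf.fix_eq c v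
  have key : ∀ u v, G.Adj u v → r u < r v → f u ≠ f v := by
    intro u v huv hlt
    rw [hf v]
    exact hne v (fun u _ ↦ f u) u huv hlt
  refine ⟨Coloring.mk f fun {u v} huv ↦ ?_, fun v ↦ ?_⟩
  · rcases hr u v huv with h | h
    · exact key u v huv h
    · exact (key v u huv.symm h).symm
  · change f v ∈ F v
    rw [hf v]
    exact hc v _

/-- Well-order the vertices and color greedily. This makes the infimum defining
`listChromaticNumber` one over a nonempty set, hence attained. -/
theorem exists_isListColorable (G : SimpleGraph V) : ∃ κ, G.IsListColorable κ := by
  let r : V → V → Prop := WellOrderingRel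
  refine ⟨Order.succ #V, isListColorable_of_rank (W := Ordinal.{u}) (typein r) ?_ fun v ↦ ?_⟩
  · intro u v huv
    exact lt_or_gt_of_ne fun h ↦ huv.ne (typein_injective r h)
  · exact Order.lt_succ_of_le (Cardinal.mk_subtype_le _)

theorem aleph0_lt_listChromaticNumber_iff :
    ℵ₀ < G.listChromaticNumber ↔ ¬ G.IsListColorable ℵ₀ := by
  refine ⟨fun h hG ↦ h.not_ge (csInf_le' hG), fun h ↦ lt_of_not_ge fun hle ↦ h ?_⟩
  have hmem : G.IsListColorable G.listChromaticNumber :=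
    csInf_mem (s := {κ | G.IsListColorable κ}) G.exists_isListColorable
  exact hmem.mono hle

end SimpleGraph

/-! ### Ladders. -/

namespace Ordinal

/-- A ladder on `δ`: a strictly increasing sequence of successor ordinals with limit `δ`. -/
structure IsLadder (a : ℕ → Ordinal.{u}) (δ : Ordinal.{u}) : Prop where
  strictMono : StrictMono a
  lt : ∀ n, a n < δ
  exists_lt : ∀ ε < δ, ∃ n, ε < a n
  exists_succ : ∀ n, ∃ b, a n = Order.succ b

theorem isSuccLimit_of_aleph0_le_cof {δ : Ordinal.{u}} (hδ : ℵ₀ ≤ δ.cof) : Order.IsSuccLimit δ :=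
  one_lt_cof_iff.1 (aleph0_le_cof_iff.1 hδ)

theorem isSuccLimit_of_cof_eq_aleph0 {δ : Ordinal.{u}} (hδ : δ.cof = ℵ₀) : Order.IsSuccLimit δ :=
  isSuccLimit_of_aleph0_le_cof hδ.ge

theorem exists_isLadder {δ : Ordinal.{u}} (hδ : δ.cof = ℵ₀) : ∃ a, IsLadder a δ := by
  have hlim := isSuccLimit_of_cof_eq_aleph0 hδ
  obtain ⟨f, hf⟩ := exists_isFundamentalSeq (o := δ) (a := ω) (by rw [hδ, ord_aleph0])
  have hcof : ∀ ε < δ, ∃ n : ℕ, ε ≤ f ⟨n, natCast_lt_omega0 n⟩ := by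
    intro ε hε
    obtain ⟨_, ⟨⟨i, hi⟩, rfl⟩, h⟩ := hf.isCofinal_range ⟨ε, hε⟩
    obtain ⟨n, rfl⟩ := lt_omega0.1 hi
    exact ⟨n, h⟩
  refine ⟨fun n ↦ Order.succ (f ⟨n, natCast_lt_omega0 n⟩), ?_, ?_, ?_, fun n ↦ ⟨_, rfl⟩⟩
  · intro m n hmn
    exact Order.succ_lt_succ (hf.strictMono (Subtype.mk_lt_mk.2 (Nat.cast_lt.2 hmn)))
  · exact fun n ↦ hlim.succ_lt (f _).2
  · intro ε hε
    obtain ⟨n, hn⟩ := hcof ε hε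
    exact ⟨n, Order.lt_succ_of_le hn⟩

namespace IsLadder

variable {a : ℕ → Ordinal.{u}} {δ : Ordinal.{u}}

theorem finite_setOf_lt (ha : IsLadder a δ) {ε : Ordinal.{u}} (hε : ε < δ) :
    {n | a n < ε}.Finite := by
  obtain ⟨N, hN⟩ := ha.exists_lt ε hε
  exact (Set.finite_lt_nat N).subset fun n hn ↦ ha.strictMono.lt_iff_lt.1 (hn.trans hN)

/-- Ladder points are successors, so they miss `S`; this makes the ladder graph bipartite. -/
theorem apply_ne (ha : IsLadder a δ) (n : ℕ) {γ : Ordinal.{u}} (hγ : γ.cof = ℵ₀) : a n ≠ γ := by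
  obtain ⟨b, hb⟩ := ha.exists_succ n
  rw [hb]
  rintro rfl
  exact absurd (isSuccLimit_of_cof_eq_aleph0 hγ).isSuccPrelimit (Order.not_isSuccPrelimit_succ b)

end IsLadder

/-! ### Non-reflection and disjoint ladder tails. -/

/-- In an ordinal without maximum in which `S` does not reflect there is an unbounded set avoiding
`S` and all limits of which lie outside of `S`. -/
theorem exists_unbounded_of_not_reflecting {S : Set Ordinal.{u}} (hS : ∀ δ ∈ S, δ.cof = ℵ₀)
    {γ : Ordinal.{u}} (hγ : Order.IsSuccLimit γ) (h : ℵ₀ < γ.cof → ¬ IsStationaryIn S γ) :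
    ∃ C : Set Ordinal.{u}, (∀ x < γ, ∃ y ∈ C, x ≤ y ∧ y < γ) ∧
      ∀ δ ∈ S, δ < γ → δ ∉ C ∧ ∃ ε < δ, ∀ y ∈ C, y < δ → y ≤ ε := by
  rcases (aleph0_le_cof_iff.2 (one_lt_cof_iff.2 hγ)).eq_or_lt with hcof | hcof
  · obtain ⟨a, ha⟩ := exists_isLadder hcof.symm
    refine ⟨Set.range a, fun x hx ↦ ?_, fun δ hδ hδγ ↦ ⟨?_, ?_⟩⟩
    · obtain ⟨n, hn⟩ := ha.exists_lt x hx
      exact ⟨a n, ⟨n, rfl⟩, hn.le, ha.lt n⟩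
    · rintro ⟨n, hn⟩
      exact ha.apply_ne n (hS δ hδ) hn
    · have hlim := isSuccLimit_of_cof_eq_aleph0 (hS δ hδ)
      have hfin := ha.finite_setOf_lt hδγ
      by_cases hne : {n | a n < δ}.Nonempty
      · obtain ⟨m, hm, hmax⟩ := hfin.exists_maximalFor a _ hne
        refine ⟨a m, hm, ?_⟩
        rintro _ ⟨n, rfl⟩ hn
        exact (le_total (a n) (a m)).elim id fun h' ↦ hmax hn h'
      · refine ⟨0, hlim.bot_lt, ?_⟩
        rintro _ ⟨n, rfl⟩ hn
        exact absurd ⟨n, hn⟩ hne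
  · obtain ⟨C, hC, hdisj⟩ := not_isStationary_iff.1 (h hcof)
    refine ⟨Subtype.val '' C, fun x hx ↦ ?_, fun δ hδ hδγ ↦ ?_⟩
    · obtain ⟨y, hy, hxy⟩ := hC.isCofinal ⟨x, hx⟩
      exact ⟨y, ⟨y, hy, rfl⟩, hxy, y.2⟩
    · have hnot : (⟨δ, hδγ⟩ : Set.Iio γ) ∉ C := fun hmem ↦
        Set.disjoint_left.1 hdisj (show (⟨δ, hδγ⟩ : Set.Iio γ) ∈ {x : Set.Iio γ | (x : Ordinal) ∈ S}
          from hδ) hmem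
      refine ⟨?_, ?_⟩
      · rintro ⟨y, hy, rfl⟩
        exact hnot hy
      · by_contra! hcon
        have hpos : 0 < δ := (isSuccLimit_of_cof_eq_aleph0 (hS δ hδ)).bot_lt
        -- Otherwise `δ` is a limit of points of `C`, hence in `C` by closedness.
        refine hnot (hC.isLUB_mem (t := {y | y ∈ C ∧ y.1 < δ}) (fun y hy ↦ hy.1) ?_ ⟨?_, ?_⟩)
        · obtain ⟨_, ⟨y, hy, rfl⟩, hlt, -⟩ := hcon 0 hpos
          exact ⟨y, hy, hlt⟩
        · exact fun y hy ↦ hy.2.le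
        · intro b hb
          by_contra! hlt
          obtain ⟨_, ⟨y, hy, rfl⟩, hyδ, hby⟩ := hcon b hlt
          exact (hb ⟨hy, hyδ⟩ : y ≤ b).not_gt hby

/-- If `S` does not reflect at any ordinal up to `γ`, then the ladders on elements of `S` below `γ`
can be made disjoint by removing a proper initial segment from each of them. -/
theorem exists_disjoint_tails {S : Set Ordinal.{u}} (hS : ∀ δ ∈ S, δ.cof = ℵ₀)
    {a : Ordinal.{u} → ℕ → Ordinal.{u}} (ha : ∀ δ ∈ S, IsLadder (a δ) δ) (γ : Ordinal.{u})
    (h : ∀ α ≤ γ, ℵ₀ < α.cof → ¬ IsStationaryIn S α) :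
    ∃ c : Ordinal.{u} → Ordinal.{u}, (∀ δ ∈ S, c δ < δ) ∧
      ∀ δ ∈ S, ∀ δ' ∈ S, δ < γ → δ' < γ → ∀ m n,
        c δ ≤ a δ m → c δ' ≤ a δ' n → a δ m = a δ' n → δ = δ' := by
  have hpos : ∀ δ ∈ S, 0 < δ := fun δ hδ ↦ (isSuccLimit_of_cof_eq_aleph0 (hS δ hδ)).bot_lt
  induction γ using Ordinal.limitRecOn with
  | zero => exact ⟨fun _ ↦ 0, hpos, fun δ _ δ' _ h0 ↦ absurd h0 not_lt_zero⟩
  | add_one β ih =>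
    obtain ⟨c, hc, hdisj⟩ := ih fun α hα ↦ h α (hα.trans (Order.le_succ β))
    by_cases hβ : β ∈ S
    -- The new ladder, on `β`, has only finitely many points below each `δ < β`; raising the cut of
    -- `δ` past them lets the ladder of `β` stay whole.
    · have hfin : ∀ δ ∈ S, δ < β → ∃ e < δ, ∀ m, a β m < δ → a β m < e := by
        intro δ hδ hlt
        by_cases hne : {m | a β m < δ}.Nonempty
        · obtain ⟨m, hm, hmax⟩ := ((ha β hβ).finite_setOf_lt hlt).exists_maximalFor (a β) _ hne
          refine ⟨Order.succ (a β m), (isSuccLimit_of_cof_eq_aleph0 (hS δ hδ)).succ_lt hm,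
            fun n hn ↦ Order.lt_succ_of_le ?_⟩
          exact (le_total (a β n) (a β m)).elim id fun h' ↦ hmax hn h'
        · exact ⟨0, hpos δ hδ, fun m hm ↦ absurd ⟨m, hm⟩ hne⟩
      choose! e he hlt using hfin
      classical
      refine ⟨fun δ ↦ if δ < β then max (c δ) (e δ) else 0, fun δ hδ ↦ ?_, ?_⟩
      · by_cases hδβ : δ < β
        · simp only [hδβ, if_true]
          exact max_lt (hc δ hδ) (he δ hδ hδβ)
        · simpa only [hδβ, if_false] using hpos δ hδ
      · have hmain : ∀ δ ∈ S, δ < β → ∀ m n, max (c δ) (e δ) ≤ a δ m → a δ m ≠ a β n := by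
          intro δ hδ hδβ m n hm heq
          have h1 := hlt δ hδ hδβ n (heq ▸ (ha δ hδ).lt m)
          exact (((le_max_right _ _).trans hm).trans heq.le).not_gt h1
        intro δ hδ δ' hδ' hδlt hδlt' m n hm hn heq
        rcases (Order.lt_add_one_iff.1 hδlt).lt_or_eq with h1 | rfl <;>
          rcases (Order.lt_add_one_iff.1 hδlt').lt_or_eq with h2 | h2
        · simp only [h1, h2, if_true] at hm hn
          exact hdisj δ hδ δ' hδ' h1 h2 m n ((le_max_left _ _).trans hm)
            ((le_max_left _ _).trans hn) heq
        · subst h2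
          simp only [h1, if_true] at hm
          exact absurd heq (hmain δ hδ h1 m n hm)
        · simp only [h2, if_true] at hn
          exact absurd heq.symm (hmain δ' hδ' h2 n m hn)
        · exact h2.symm
    · refine ⟨c, hc, fun δ hδ δ' hδ' h1 h2 ↦ hdisj δ hδ δ' hδ' ?_ ?_⟩
      · exact (Order.lt_add_one_iff.1 h1).lt_of_ne (ne_of_mem_of_not_mem hδ hβ)
      · exact (Order.lt_add_one_iff.1 h2).lt_of_ne (ne_of_mem_of_not_mem hδ' hβ)
  | limit γ hγ ih =>
    obtain ⟨C, hcof, hC⟩ := exists_unbounded_of_not_reflecting hS hγ (h γ le_rfl)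
    have ih' : ∀ β, ∃ c : Ordinal.{u} → Ordinal.{u}, (∀ δ ∈ S, c δ < δ) ∧ (β < γ →
        ∀ δ ∈ S, ∀ δ' ∈ S, δ < β → δ' < β → ∀ m n,
          c δ ≤ a δ m → c δ' ≤ a δ' n → a δ m = a δ' n → δ = δ') := by
      intro β
      by_cases hβ : β < γ
      · obtain ⟨c, h1, h2⟩ := ih β hβ fun α hα ↦ h α (hα.trans hβ.le)
        exact ⟨c, h1, fun _ ↦ h2⟩
      · exact ⟨fun _ ↦ 0, hpos, fun hβ' ↦ absurd hβ' hβ⟩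
    choose c hc hdisj using ih'
    have hε : ∀ δ ∈ S, ∃ ε < δ, δ < γ → ∀ y ∈ C, y < δ → y < ε := by
      intro δ hδ
      by_cases hδγ : δ < γ
      · obtain ⟨-, ε, hε, hle⟩ := hC δ hδ hδγ
        exact ⟨Order.succ ε, (isSuccLimit_of_cof_eq_aleph0 (hS δ hδ)).succ_lt hε,
          fun _ y hy hyδ ↦ Order.lt_succ_of_le (hle y hy hyδ)⟩
      · exact ⟨0, hpos δ hδ, fun h' ↦ absurd h' hδγ⟩
    choose! ε hεlt hεC using hε
    -- `C` cuts `γ` into intervals, and `t δ` is the right end of the one containing `δ`. Inside an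
    -- interval the cuts for `t δ` apply; `ε δ` keeps tails from crossing into earlier intervals.
    let t : Ordinal.{u} → Ordinal.{u} := fun δ ↦ sInf {y | y ∈ C ∧ δ ≤ y}
    have ht : ∀ δ ∈ S, δ < γ → t δ ∈ C ∧ δ < t δ ∧ t δ < γ := by
      intro δ hδ hδγ
      obtain ⟨y, hy, hδy, hyγ⟩ := hcof δ hδγ
      have hmem : t δ ∈ {y | y ∈ C ∧ δ ≤ y} := csInf_mem ⟨y, hy, hδy⟩
      refine ⟨hmem.1, hmem.2.lt_of_ne ?_, (csInf_le' (show y ∈ {y | y ∈ C ∧ δ ≤ y} from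
        ⟨hy, hδy⟩)).trans_lt hyγ⟩
      exact fun heq ↦ (hC δ hδ hδγ).1 (heq ▸ hmem.1)
    have htle : ∀ δ y, y ∈ C → δ ≤ y → t δ ≤ y := fun δ y hy hle ↦ csInf_le' ⟨hy, hle⟩
    refine ⟨fun δ ↦ max (c (t δ) δ) (ε δ), fun δ hδ ↦ max_lt (hc _ δ hδ) (hεlt δ hδ), ?_⟩
    have hsep : ∀ δ ∈ S, ∀ δ' ∈ S, δ < γ → δ' < γ → ∀ m n, ε δ' ≤ a δ' n → a δ m = a δ' n →
        δ' ≤ t δ := by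
      intro δ hδ δ' hδ' hδγ hδγ' m n hn heq
      obtain ⟨htC, hδt, -⟩ := ht δ hδ hδγ
      by_contra! hlt
      have h1 := hεC δ' hδ' hδγ' (t δ) htC hlt
      exact ((h1.trans_le hn).trans_eq heq.symm).not_gt (((ha δ hδ).lt m).trans hδt)
    intro δ hδ δ' hδ' hδγ hδγ' m n hm hn heq
    obtain ⟨htC, hδt, htγ⟩ := ht δ hδ hδγ
    obtain ⟨htC', hδt', -⟩ := ht δ' hδ' hδγ'
    have h1 := hsep δ hδ δ' hδ' hδγ hδγ' m n ((le_max_right _ _).trans hn) heq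
    have h2 := hsep δ' hδ' δ hδ hδγ' hδγ n m ((le_max_right _ _).trans hm) heq.symm
    have htt : t δ = t δ' := le_antisymm (htle δ _ htC' h2) (htle δ' _ htC h1)
    refine hdisj (t δ) htγ δ hδ δ' hδ' hδt (htt ▸ hδt') m n ((le_max_left _ _).trans hm) ?_ heq
    rw [htt]
    exact (le_max_left _ _).trans hn

/-! ### Guessing sequences from `2 ^ μ ≤ μ⁺`. -/

theorem mk_Iio_ord (μ : Cardinal.{u}) : #(Set.Iio μ.ord) = Cardinal.lift.{u + 1} μ := by
  rw [Cardinal.mk_Iio_ordinal, Cardinal.card_ord]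

/-- Every ordinal below `μ⁺` injects into the initial ordinal of `μ`. -/
theorem exists_injOn_Iio {μ : Cardinal.{u}} {δ : Ordinal.{u}} (hδ : δ < (Order.succ μ).ord) :
    ∃ j : Ordinal.{u} → Ordinal.{u}, (∀ x < δ, j x < μ.ord) ∧ Set.InjOn j (Set.Iio δ) := by
  have hle : #(Set.Iio δ) ≤ #(Set.Iio μ.ord) := by
    rw [mk_Iio_ord, Cardinal.mk_Iio_ordinal, Cardinal.lift_le]
    exact Order.lt_succ_iff.1 (lt_ord.1 hδ)
  obtain ⟨f⟩ := hle
  classical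
  refine ⟨fun x ↦ if hx : x < δ then f ⟨x, hx⟩ else 0, fun x hx ↦ ?_, fun x hx y hy h ↦ ?_⟩
  · simp only [hx, dif_pos]
    exact (f ⟨x, hx⟩).2
  · rw [Set.mem_Iio] at hx hy
    simp only [hx, hy, dif_pos] at h
    exact congrArg Subtype.val (f.injective (Subtype.ext h))

/-- Under `2 ^ μ ≤ μ⁺` the `μ × μ`-indexed families of functions from an ordinal `α < μ⁺` to the
natural numbers can be enumerated in order type `μ⁺`. -/
theorem exists_enumeration {μ : Cardinal.{u}} (hμ : ℵ₀ ≤ μ)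
    (h2 : (2 : Cardinal.{u}) ^ μ ≤ Order.succ μ) {α : Ordinal.{u}} (hα : α < (Order.succ μ).ord) :
    ∃ e : Ordinal.{u} → Ordinal.{u} → Ordinal.{u} → Ordinal.{u} → ℕ,
      ∀ h : Ordinal.{u} → Ordinal.{u} → Ordinal.{u} → ℕ, ∃ β < (Order.succ μ).ord,
        ∀ i < μ.ord, ∀ η < μ.ord, ∀ x < α, e β i η x = h i η x := by
  let T := Set.Iio μ.ord × Set.Iio μ.ord × Set.Iio α → ℕ
  have hT : #T ≤ #(Set.Iio (Order.succ μ).ord) := by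
    have hαμ : #(Set.Iio α) ≤ Cardinal.lift.{u + 1} μ := by
      rw [Cardinal.mk_Iio_ordinal, Cardinal.lift_le]
      exact Order.lt_succ_iff.1 (lt_ord.1 hα)
    have hlift : ℵ₀ ≤ Cardinal.lift.{u + 1} μ := Cardinal.aleph0_le_lift.2 hμ
    have hprod : #(Set.Iio μ.ord × Set.Iio μ.ord × Set.Iio α) ≤ Cardinal.lift.{u + 1} μ := by
      simp only [Cardinal.mk_prod, Cardinal.lift_id, mk_Iio_ord]
      calc _ ≤ Cardinal.lift.{u + 1} μ * (Cardinal.lift.{u + 1} μ * Cardinal.lift.{u + 1} μ) := by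
            gcongr
        _ = _ := by rw [Cardinal.mul_eq_self hlift, Cardinal.mul_eq_self hlift]
    calc #T = ℵ₀ ^ #(Set.Iio μ.ord × Set.Iio μ.ord × Set.Iio α) := by simp [T]
      _ ≤ ℵ₀ ^ Cardinal.lift.{u + 1} μ := Cardinal.power_le_power_left Cardinal.aleph0_ne_zero hprod
      _ = 2 ^ Cardinal.lift.{u + 1} μ :=
        Cardinal.power_eq_two_power hlift Cardinal.ofNat_le_aleph0 hlift
      _ = Cardinal.lift.{u + 1} (2 ^ μ) := by simp
      _ ≤ _ := by rw [mk_Iio_ord, Cardinal.lift_le]; exact h2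
  obtain ⟨f⟩ := hT
  have hinv : ∀ β : Ordinal.{u}, ∃ g : T, ∀ t : T, (f t : Ordinal.{u}) = β → g = t := by
    intro β
    by_cases hβ : ∃ t, (f t : Ordinal.{u}) = β
    · obtain ⟨t, ht⟩ := hβ
      exact ⟨t, fun t' ht' ↦ f.injective (Subtype.ext (ht.trans ht'.symm))⟩
    · exact ⟨fun _ ↦ 0, fun t ht ↦ absurd ⟨t, ht⟩ hβ⟩
  choose g hg using hinv
  classical
  refine ⟨fun β i η x ↦ if hh : i < μ.ord ∧ η < μ.ord ∧ x < α then
    g β (⟨i, hh.1⟩, ⟨η, hh.2.1⟩, ⟨x, hh.2.2⟩) else 0, fun h ↦ ?_⟩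
  let t : T := fun p ↦ h p.1 p.2.1 p.2.2
  refine ⟨f t, (f t).2, fun i hi η hη x hx ↦ ?_⟩
  simp only [hi, hη, hx, and_self, dif_pos]
  rw [hg (f t) t rfl]

/-- A stationary subset of `μ⁺` meets the club of ordinals closed under a given function. -/
theorem exists_mem_closed_of_isStationaryIn {S : Set Ordinal.{u}} {κ : Ordinal.{u}}
    (hκ : κ.cof.ord = κ) (hκ' : ℵ₀ < κ.cof) (hS : IsStationaryIn S κ)
    {f : Ordinal.{u} → Ordinal.{u}} (hf : ∀ x < κ, f x < κ) :
    ∃ δ ∈ S, δ < κ ∧ ∀ x < δ, f x < δ := by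
  let C : Set (Set.Iio κ) := {δ | ∀ x < δ.1, f x < δ.1}
  have hC : IsClub C := by
    refine ⟨fun d hd hd₀ _ b hb x hx ↦ ?_, fun b ↦ ?_⟩
    · have hbκ : x < κ := hx.trans b.2
      obtain ⟨y, hy, hxy⟩ := (lt_isLUB_iff hb).1 (show (⟨x, hbκ⟩ : Set.Iio κ) < b from hx)
      exact (hd hy x hxy).trans_le (hb.1 hy)
    -- `f x < g y` for `x < y`, so the supremum of the iterates of `g` is closed under `f`.
    · let g : Ordinal.{u} → Ordinal.{u} := fun y ↦
        max (Order.succ y) (⨆ x : Set.Iio y, Order.succ (f x))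
      have hlim : Order.IsSuccLimit κ := isSuccLimit_of_aleph0_le_cof hκ'.le
      have hg : ∀ y < κ, g y < κ := by
        intro y hy
        refine max_lt (hlim.succ_lt hy) (lift_iSup_lt_of_lt_cof ?_ fun x ↦
          hlim.succ_lt (hf x (x.2.trans hy)))
        rw [← lift_cof, Cardinal.mk_Iio_ordinal, Cardinal.lift_lift, Cardinal.lift_lt]
        exact lt_ord.1 (hy.trans_eq hκ.symm)
      refine ⟨⟨nfp g b, nfp_lt_ord hκ' hg b.2⟩, fun x hx ↦ ?_, le_nfp g b⟩
      obtain ⟨n, hn⟩ := lt_nfp_iff.1 hx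
      refine lt_of_lt_of_le ?_ (iterate_le_nfp g b (n + 1))
      rw [Function.iterate_succ_apply']
      refine (Order.lt_succ (f x)).trans_le (le_trans ?_ (le_max_right _ _))
      exact Ordinal.le_iSup (fun x : Set.Iio (g^[n] b) ↦ Order.succ (f x)) ⟨x, hn⟩
  obtain ⟨δ, hδS, hδ⟩ := hS hC
  exact ⟨δ, hδS, δ.2, hδ⟩

/-- The pairs `(α, β)` in the `i`-th piece of `δ × δ` for which the `β`-th approximation on `α`
agrees with `z ζ` for all `ζ < η`. -/
def approximations (j : Ordinal.{u} → Ordinal.{u} → Ordinal.{u})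
    (e : Ordinal.{u} → Ordinal.{u} → Ordinal.{u} → Ordinal.{u} → Ordinal.{u} → ℕ)
    (i : Ordinal.{u}) (z : Ordinal.{u} → Ordinal.{u} → ℕ) (η δ : Ordinal.{u}) :
    Set (Ordinal.{u} × Ordinal.{u}) :=
  {p | p.1 < δ ∧ p.2 < δ ∧ j δ p.1 < i ∧ j δ p.2 < i ∧
    ∀ ζ < η, ∀ x < p.1, e p.1 p.2 i ζ x = z ζ x}

open Classical in
/-- The value at `x` predicted by some approximation whose domain contains `x`. -/
noncomputable def approximationValue (j : Ordinal.{u} → Ordinal.{u} → Ordinal.{u})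
    (e : Ordinal.{u} → Ordinal.{u} → Ordinal.{u} → Ordinal.{u} → Ordinal.{u} → ℕ)
    (i : Ordinal.{u}) (z : Ordinal.{u} → Ordinal.{u} → ℕ) (η δ x : Ordinal.{u}) : ℕ :=
  if h : ∃ p ∈ approximations j e i z η δ, x < p.1 then
    e h.choose.1 h.choose.2 i η x else 0

theorem exists_approximationValue_eq {j : Ordinal.{u} → Ordinal.{u} → Ordinal.{u}}
    {e : Ordinal.{u} → Ordinal.{u} → Ordinal.{u} → Ordinal.{u} → Ordinal.{u} → ℕ}
    {i : Ordinal.{u}} {z : Ordinal.{u} → Ordinal.{u} → ℕ} {η δ x : Ordinal.{u}}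
    (h : ∃ p ∈ approximations j e i z η δ, x < p.1) :
    ∃ p ∈ approximations j e i z η δ, x < p.1 ∧
      approximationValue j e i z η δ x = e p.1 p.2 i η x :=
  ⟨h.choose, h.choose_spec.1, h.choose_spec.2, by rw [approximationValue, dif_pos h]⟩

theorem approximationValue_congr {j : Ordinal.{u} → Ordinal.{u} → Ordinal.{u}}
    {e : Ordinal.{u} → Ordinal.{u} → Ordinal.{u} → Ordinal.{u} → Ordinal.{u} → ℕ}
    {i : Ordinal.{u}} {z z' : Ordinal.{u} → Ordinal.{u} → ℕ} {η : Ordinal.{u}}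
    (h : ∀ ζ < η, z ζ = z' ζ) :
    approximationValue j e i z η = approximationValue j e i z' η := by
  have : approximations j e i z η = approximations j e i z' η := by
    funext δ
    ext p
    simp +contextual [approximations, h]
  funext δ x
  unfold approximationValue
  rw [this]

/-- If no sequence of guesses succeeds, then by recursion there is a sequence of functions each of
which evades the guesses computed from the previous ones. -/
theorem exists_evading_sequence {S : Set Ordinal.{u}}
    (hbad : ∀ g : Ordinal.{u} → Ordinal.{u} → ℕ, ∃ f : Ordinal.{u} → ℕ,
      ∀ δ ∈ S, ∃ x < δ, f x ≠ g δ x)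
    (j : Ordinal.{u} → Ordinal.{u} → Ordinal.{u})
    (e : Ordinal.{u} → Ordinal.{u} → Ordinal.{u} → Ordinal.{u} → Ordinal.{u} → ℕ)
    (i : Ordinal.{u}) :
    ∃ z : Ordinal.{u} → Ordinal.{u} → ℕ, ∀ η, ∀ δ ∈ S, ∃ x < δ,
      z η x ≠ approximationValue j e i z η δ x := by
  classical
  choose F hF using hbad
  let extend (η : Ordinal.{u}) (w : ∀ ζ, ζ < η → Ordinal.{u} → ℕ) :
      Ordinal.{u} → Ordinal.{u} → ℕ :=
    fun ζ ↦ if h : ζ < η then w ζ h else fun _ ↦ 0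
  let step (η : Ordinal.{u}) (w : ∀ ζ, ζ < η → Ordinal.{u} → ℕ) : Ordinal.{u} → ℕ :=
    F (approximationValue j e i (extend η w) η)
  let z : Ordinal.{u} → Ordinal.{u} → ℕ := (wellFounded_lt (α := Ordinal.{u})).fix step
  have hz : ∀ η, z η = F (approximationValue j e i z η) := by
    intro η
    have h1 : z η = step η fun ζ _ ↦ z ζ := WellFounded.fix_eq _ step η
    rw [h1]
    refine congrArg F (approximationValue_congr fun ζ hζ ↦ ?_)
    simp only [extend, hζ, dif_pos]
  refine ⟨z, fun η δ hδ ↦ ?_⟩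
  rw [hz η]
  exact hF _ δ hδ

/-- The part of Shelah's theorem on diamonds needed here: if `2 ^ μ ≤ μ⁺`, where `μ` has
uncountable cofinality, and `S` is a stationary set of ordinals below `μ⁺` of countable cofinality,
then some sequence of functions guesses every function on `μ⁺` at some element of `S`. -/
theorem exists_guessing_sequence {μ : Cardinal.{u}} (hμ : ℵ₀ ≤ μ) (hcof : ℵ₀ < μ.ord.cof)
    (h2 : (2 : Cardinal.{u}) ^ μ ≤ Order.succ μ) {S : Set Ordinal.{u}}
    (hS : ∀ δ ∈ S, δ < (Order.succ μ).ord ∧ δ.cof = ℵ₀)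
    (hstat : IsStationaryIn S (Order.succ μ).ord) :
    ∃ g : Ordinal.{u} → Ordinal.{u} → ℕ, ∀ f : Ordinal.{u} → ℕ, ∃ δ ∈ S, ∀ x < δ, f x = g δ x := by
  by_contra! hbad
  have hreg : (Order.succ μ).ord.cof = Order.succ μ := (isRegular_succ hμ).cof_ord
  have hj : ∀ δ : Ordinal.{u}, ∃ j : Ordinal.{u} → Ordinal.{u}, δ < (Order.succ μ).ord →
      (∀ x < δ, j x < μ.ord) ∧ Set.InjOn j (Set.Iio δ) := by
    intro δ
    by_cases hδ : δ < (Order.succ μ).ord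
    · obtain ⟨j, hj⟩ := exists_injOn_Iio hδ
      exact ⟨j, fun _ ↦ hj⟩
    · exact ⟨id, fun h ↦ absurd h hδ⟩
  choose j hj using hj
  have he : ∀ α : Ordinal.{u}, ∃ e : Ordinal.{u} → Ordinal.{u} → Ordinal.{u} → Ordinal.{u} → ℕ,
      α < (Order.succ μ).ord → ∀ h : Ordinal.{u} → Ordinal.{u} → Ordinal.{u} → ℕ,
        ∃ β < (Order.succ μ).ord, ∀ i < μ.ord, ∀ η < μ.ord, ∀ x < α, e β i η x = h i η x := by
    intro α
    by_cases hα : α < (Order.succ μ).ord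
    · obtain ⟨e, he⟩ := exists_enumeration hμ h2 hα
      exact ⟨e, fun _ ↦ he⟩
    · exact ⟨fun _ _ _ _ ↦ 0, fun h ↦ absurd h hα⟩
  choose e he using he
  choose z hz using exists_evading_sequence hbad j e
  have hf : ∀ α : Ordinal.{u}, ∃ β, α < (Order.succ μ).ord → β < (Order.succ μ).ord ∧
      ∀ i < μ.ord, ∀ η < μ.ord, ∀ x < α, e α β i η x = z i η x := by
    intro α
    by_cases hα : α < (Order.succ μ).ord
    · obtain ⟨β, hβ⟩ := he α hα z
      exact ⟨β, fun _ ↦ hβ⟩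
    · exact ⟨0, fun h ↦ absurd h hα⟩
  choose f hf using hf
  obtain ⟨δ, hδS, hδκ, hδf⟩ := exists_mem_closed_of_isStationaryIn
    (κ := (Order.succ μ).ord) (by rw [hreg]) (by rw [hreg]; exact Order.lt_succ_of_le hμ)
    hstat (f := f) fun x hx ↦ (hf x hx).1
  obtain ⟨hjlt, hjinj⟩ := hj δ hδκ
  obtain ⟨a, ha⟩ := exists_isLadder (hS δ hδS).2
  have hμlim : Order.IsSuccLimit μ.ord := isSuccLimit_of_aleph0_le_cof hcof.le
  -- The `n`-th correct code enters the pieces from index `s n` on; as `cof μ > ω`, one `i < μ`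
  -- serves all `n`.
  let s : ℕ → Ordinal.{u} := fun n ↦ Order.succ (max (j δ (a n)) (j δ (f (a n))))
  have hs : ∀ n, s n < μ.ord := fun n ↦
    hμlim.succ_lt (max_lt (hjlt _ (ha.lt n)) (hjlt _ (hδf _ (ha.lt n))))
  let i : Ordinal.{u} := ⨆ n, s n
  have hi : i < μ.ord := by
    refine lift_iSup_lt_of_lt_cof ?_ hs
    simpa using hcof
  have hmem : ∀ η < μ.ord, ∀ n, (a n, f (a n)) ∈ approximations j e i (z i) η δ := by
    intro η hη n
    have hsn : Order.succ (max (j δ (a n)) (j δ (f (a n)))) ≤ i := Ordinal.le_iSup s n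
    have hlt := Order.succ_le_iff.1 hsn
    exact ⟨ha.lt n, hδf _ (ha.lt n), (le_max_left _ _).trans_lt hlt,
      (le_max_right _ _).trans_lt hlt,
      fun ζ hζ ↦ (hf _ ((ha.lt n).trans hδκ)).2 i hi ζ (hζ.trans hη)⟩
  have hp : ∀ η : Set.Iio μ.ord, ∃ p ∈ approximations j e i (z i) η δ, ∃ x < p.1,
      e p.1 p.2 i η x ≠ z i η x := by
    intro η
    obtain ⟨x, hx, hne⟩ := hz i η δ hδS
    obtain ⟨n, hn⟩ := ha.exists_lt x hx
    obtain ⟨p, hp, hxp, hval⟩ := exists_approximationValue_eq ⟨_, hmem η η.2 n, hn⟩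
    exact ⟨p, hp, x, hxp, fun h ↦ hne (h.symm.trans hval.symm)⟩
  choose p hpmem x hx hne using hp
  -- The code `p η` errs at stage `η`, whereas `p η'` must agree with `z i` at every stage before
  -- `η'`.
  have hdiff : ∀ η η' : Set.Iio μ.ord, η < η' → p η ≠ p η' := by
    intro η η' hlt heq
    refine hne η ?_
    have hxη := hx η
    rw [heq] at hxη ⊢
    exact (hpmem η').2.2.2.2 η hlt _ hxη
  let q : Set.Iio μ.ord → Set.Iio i × Set.Iio i := fun η ↦
    (⟨j δ (p η).1, (hpmem η).2.2.1⟩, ⟨j δ (p η).2, (hpmem η).2.2.2.1⟩)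
  have hq : Function.Injective q := by
    intro η η' h
    have h1 : (p η).1 = (p η').1 := hjinj (hpmem η).1 (hpmem η').1
      (congrArg (fun r : Set.Iio i × Set.Iio i ↦ (r.1 : Ordinal.{u})) h)
    have h3 : (p η).2 = (p η').2 := hjinj (hpmem η).2.1 (hpmem η').2.1
      (congrArg (fun r : Set.Iio i × Set.Iio i ↦ (r.2 : Ordinal.{u})) h)
    have heq : p η = p η' := Prod.ext h1 h3
    rcases lt_trichotomy η η' with h4 | h4 | h4
    · exact absurd heq (hdiff _ _ h4)
    · exact h4
    · exact absurd heq.symm (hdiff _ _ h4)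
  have hcard := Cardinal.mk_le_of_injective hq
  rw [mk_Iio_ord, Cardinal.mk_prod, Cardinal.lift_id, Cardinal.mk_Iio_ordinal,
    ← Cardinal.lift_mul, Cardinal.lift_le] at hcard
  exact hcard.not_gt (Cardinal.mul_lt_of_lt hμ (lt_ord.1 hi) (lt_ord.1 hi))

/-! ### The ladder graph. -/

/-- The graph on the ordinals below `κ` which joins each `δ ∈ S` to the points of its ladder. -/
def ladderGraph (κ : Ordinal.{u}) (S : Set Ordinal.{u}) (a : Ordinal.{u} → ℕ → Ordinal.{u}) :
    SimpleGraph κ.ToType :=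
  SimpleGraph.fromRel fun u v ↦ (u.toOrd : Ordinal.{u}) ∈ S ∧
    ∃ n, (v.toOrd : Ordinal.{u}) = a u.toOrd n

variable {κ : Ordinal.{u}} {S : Set Ordinal.{u}} {a : Ordinal.{u} → ℕ → Ordinal.{u}}

theorem toOrd_injective {u v : κ.ToType} (h : (u.toOrd : Ordinal.{u}) = v.toOrd) : u = v :=
  ToType.mk.symm.injective (Subtype.ext h)

theorem omega0_mul_add_natCast_inj {α β : Ordinal.{u}} {m n : ℕ}
    (h : ω * α + m = ω * β + n) : α = β ∧ m = n := by
  have hdiv : ∀ (α : Ordinal.{u}) (m : ℕ), (ω * α + m) / ω = α := fun α m ↦ by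
    rw [mul_add_div _ omega0_ne_zero, div_eq_zero_of_lt (natCast_lt_omega0 m), add_zero]
  have h1 : α = β := by rw [← hdiv α m, h, hdiv]
  subst h1
  exact ⟨rfl, Nat.cast_injective (add_left_cancel h)⟩

/-- If `g` guesses every function at some element of `S`, then lists of disjoint countable sets off
`S`, together with the lists of guessed colors on `S`, do not admit a good coloring. -/
theorem not_isListColorable_ladderGraph (hκ : ∀ δ ∈ S, δ < κ) (hS : ∀ δ ∈ S, δ.cof = ℵ₀)
    (ha : ∀ δ ∈ S, IsLadder (a δ) δ) (g : Ordinal.{u} → Ordinal.{u} → ℕ)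
    (hg : ∀ f : Ordinal.{u} → ℕ, ∃ δ ∈ S, ∀ x < δ, f x = g δ x) :
    ¬ (ladderGraph κ S a).IsListColorable ℵ₀ := by
  classical
  intro hcol
  -- The block `ω * α + n` codes the pair `(α, n)`. A color at `δ ∈ S` names a ladder point together
  -- with its guessed color, so a correct guess forces a clash.
  let F : κ.ToType → Set Ordinal.{u} := fun v ↦
    if (v.toOrd : Ordinal.{u}) ∈ S then
      Set.range fun n : ℕ ↦ ω * a v.toOrd n + g v.toOrd (a v.toOrd n)
    else Set.range fun n : ℕ ↦ ω * (v.toOrd : Ordinal.{u}) + n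
  have hcard : ∀ f : ℕ → Ordinal.{u}, Function.Injective f →
      #(Set.range f) = Cardinal.lift.{u + 1, u} ℵ₀ := by
    intro f hf
    have := Set.infinite_coe_iff.2 (Set.infinite_range_of_injective hf)
    have := (Set.countable_range f).to_subtype
    rw [Cardinal.mk_eq_aleph0, Cardinal.lift_aleph0]
  obtain ⟨f, hf⟩ := hcol F fun v ↦ by
    by_cases hv : (v.toOrd : Ordinal.{u}) ∈ S
    · simp only [F, hv, if_true]
      exact hcard _ fun m n h ↦ (ha _ hv).strictMono.injective (omega0_mul_add_natCast_inj h).1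
    · simp only [F, hv, if_false]
      exact hcard _ fun m n h ↦ (omega0_mul_add_natCast_inj h).2
  have hchoice : ∀ β : Ordinal.{u}, ∃ k : ℕ, ∀ v : κ.ToType, (v.toOrd : Ordinal.{u}) = β → β ∉ S →
      f v = ω * β + k := by
    intro β
    by_cases hβ : ∃ v : κ.ToType, (v.toOrd : Ordinal.{u}) = β ∧ β ∉ S
    · obtain ⟨v, rfl, hv⟩ := hβ
      have hfv := hf v
      simp only [F, hv, if_false] at hfv
      obtain ⟨k, hk⟩ := hfv
      refine ⟨k, fun w hw _ ↦ ?_⟩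
      rw [toOrd_injective hw]
      exact hk.symm
    · exact ⟨0, fun v hv hβS ↦ absurd ⟨v, hv, hβS⟩ hβ⟩
  choose k hk using hchoice
  obtain ⟨δ, hδ, hguess⟩ := hg k
  let v : κ.ToType := ToType.mk ⟨δ, hκ δ hδ⟩
  have hv : (v.toOrd : Ordinal.{u}) = δ := by simp [v]
  have hfv := hf v
  simp only [F, hv, hδ, if_true] at hfv
  obtain ⟨n, hn⟩ := hfv
  have hlt : a δ n < δ := (ha δ hδ).lt n
  let w : κ.ToType := ToType.mk ⟨a δ n, hlt.trans (hκ δ hδ)⟩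
  have hw : (w.toOrd : Ordinal.{u}) = a δ n := by simp [w]
  have hnot : a δ n ∉ S := fun h ↦ (ha δ hδ).apply_ne n (hS _ h) rfl
  have hfw : f w = f v := by
    rw [hk _ w hw hnot, hguess _ hlt]
    exact hn
  refine f.valid (v := w) (w := v) ?_ hfw
  refine (SimpleGraph.fromRel_adj _ _ _).2 ⟨fun h ↦ ?_, Or.inr ⟨hv ▸ hδ, n, by rw [hw, hv]⟩⟩
  rw [h, hv] at hw
  exact hlt.ne hw.symm

/-- If `S` does not reflect below `κ`, then every subgraph of the ladder graph with fewer than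
`cof κ` vertices is countably list-colorable. -/
theorem isListColorable_coe_subgraph_ladderGraph (hS : ∀ δ ∈ S, δ.cof = ℵ₀)
    (ha : ∀ δ ∈ S, IsLadder (a δ) δ) (hκ : ℵ₀ ≤ κ.cof) (hrefl : ¬ ReflectsBelow S κ)
    (Y : (ladderGraph κ S a).Subgraph) (hY : #Y.verts < κ.cof) :
    Y.coe.IsListColorable ℵ₀ := by
  classical
  let φ : Y.verts → Ordinal.{u} := fun v ↦ v.1.toOrd
  have hφ : Function.Injective φ := fun u v h ↦ Subtype.ext (toOrd_injective h)
  let γ : Ordinal.{u} := ⨆ v, Order.succ (φ v)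
  have hγ : γ < κ := iSup_lt_of_lt_cof hY fun v ↦
    (isSuccLimit_of_aleph0_le_cof hκ).succ_lt v.1.toOrd.2
  have hφγ : ∀ v, φ v < γ := fun v ↦
    Order.succ_le_iff.1 (Ordinal.le_iSup (fun v ↦ Order.succ (φ v)) v)
  obtain ⟨c, hc, hdisj⟩ := exists_disjoint_tails hS ha γ fun α hα hcof hst ↦
    hrefl ⟨α, hα.trans_lt hγ, hcof, hst⟩
  have hadj : ∀ u v, Y.coe.Adj u v → (φ u ∈ S ∧ φ v ∉ S ∧ ∃ n, φ v = a (φ u) n) ∨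
      (φ v ∈ S ∧ φ u ∉ S ∧ ∃ n, φ u = a (φ v) n) := by
    have hnot : ∀ δ ∈ S, ∀ n, a δ n ∉ S := fun δ hδ n h ↦ (ha δ hδ).apply_ne n (hS _ h) rfl
    intro u v huv
    obtain ⟨-, ⟨h1, n, h2⟩ | ⟨h1, n, h2⟩⟩ := (SimpleGraph.fromRel_adj _ _ _).1 (Y.adj_sub huv)
    · exact Or.inl ⟨h1, fun h ↦ hnot _ h1 n (h2 ▸ h), n, h2⟩
    · exact Or.inr ⟨h1, fun h ↦ hnot _ h1 n (h2 ▸ h), n, h2⟩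
  -- Placing `δ ∈ S` at its cut `c δ`, just before the point `c δ` itself, leaves only the finitely
  -- many ladder points below the cut smaller than `δ`. A point off `S` has at most one smaller
  -- neighbor, by disjointness of tails.
  let r : Y.verts → Ordinal.{u} ×ₗ ℕ := fun v ↦
    if φ v ∈ S then toLex (c (φ v), 0) else toLex (φ v, 1)
  have hr₁ : ∀ u v, φ u ∈ S → φ v ∉ S → (r u < r v ↔ c (φ u) ≤ φ v) := by
    intro u v hu hv
    simp [r, hu, hv, Prod.Lex.toLex_lt_toLex, le_iff_lt_or_eq]
  have hr₂ : ∀ u v, φ u ∈ S → φ v ∉ S → (r v < r u ↔ φ v < c (φ u)) := by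
    intro u v hu hv
    simp [r, hu, hv, Prod.Lex.toLex_lt_toLex]
  refine SimpleGraph.isListColorable_of_rank r (fun u v huv ↦ ?_) fun v ↦ ?_
  · rcases hadj u v huv with ⟨hu, hv, -⟩ | ⟨hv, hu, -⟩
    · rw [hr₁ u v hu hv, hr₂ u v hu hv]
      exact le_or_gt _ _
    · rw [hr₁ v u hv hu, hr₂ v u hv hu]
      exact (le_or_gt _ _).symm
  · rw [Cardinal.mk_lt_aleph0_iff]
    by_cases hv : φ v ∈ S
    · have hfin := ((ha _ hv).finite_setOf_lt (hc _ hv)).image (a (φ v))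
      refine Set.finite_univ_iff.1 (Set.Finite.subset (hfin.preimage
        (f := fun u : {u // Y.coe.Adj u v ∧ r u < r v} ↦ φ u.1)
        fun u _ w _ h ↦ Subtype.ext (hφ h)) ?_)
      rintro ⟨u, huv, hlt⟩ -
      rcases hadj u v huv with ⟨-, hv', -⟩ | ⟨-, hu, n, hn⟩
      · exact absurd hv hv'
      · rw [hr₂ v u hv hu] at hlt
        exact ⟨n, hn.symm.trans_lt hlt, hn.symm⟩
    · have : Subsingleton {u // Y.coe.Adj u v ∧ r u < r v} := by
        refine ⟨fun ⟨u, huv, hlt⟩ ⟨w, hwv, hlt'⟩ ↦ Subtype.ext (hφ ?_)⟩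
        rcases hadj u v huv with ⟨hu, -, m, hm⟩ | ⟨hv', -, -⟩
        · rcases hadj w v hwv with ⟨hw, -, n, hn⟩ | ⟨hv', -, -⟩
          · rw [hr₁ u v hu hv] at hlt
            rw [hr₁ w v hw hv] at hlt'
            exact hdisj _ hu _ hw (hφγ u) (hφγ w) m n (hm ▸ hlt) (hn ▸ hlt') (hm.symm.trans hn)
          · exact absurd hv' hv
        · exact absurd hv' hv
      infer_instance

end Ordinal

theorem proposition4 (hRefl : ListReflection.{u}) (μ : Cardinal.{u}) (hμ : ℵ₁ ≤ μ)
    (hcof : ℵ₀ < μ.ord.cof) :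
    Order.succ μ < (2 : Cardinal.{u}) ^ μ ∨
      ∀ S : Set Ordinal.{u}, S ⊆ {α | α < (Order.succ μ).ord ∧ α.cof = ℵ₀} →
        IsStationaryIn S (Order.succ μ).ord → ReflectsBelow S (Order.succ μ).ord := by
  rw [or_iff_not_imp_left, not_lt]
  intro h2 S hS hstat
  have hμ₀ : ℵ₀ ≤ μ := (Cardinal.aleph0_le_aleph 1).trans hμ
  have hreg : (Order.succ μ).ord.cof = Order.succ μ := (isRegular_succ hμ₀).cof_ord
  have hSκ : ∀ δ ∈ S, δ < (Order.succ μ).ord := fun δ hδ ↦ (hS hδ).1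
  have hScof : ∀ δ ∈ S, δ.cof = ℵ₀ := fun δ hδ ↦ (hS hδ).2
  by_contra hnrefl
  obtain ⟨g, hg⟩ := exists_guessing_sequence hμ₀ hcof h2 (fun δ hδ ↦ hS hδ) hstat
  have hladder : ∀ δ : Ordinal.{u}, ∃ a : ℕ → Ordinal.{u}, δ ∈ S → IsLadder a δ := by
    intro δ
    by_cases hδ : δ ∈ S
    · obtain ⟨a, ha⟩ := exists_isLadder (hScof δ hδ)
      exact ⟨a, fun _ ↦ ha⟩
    · exact ⟨fun _ ↦ 0, fun h ↦ absurd h hδ⟩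
  choose a ha using hladder
  obtain ⟨Y, hY, hlist⟩ := hRefl (Order.succ μ) (hμ₀.trans (Order.le_succ μ)) _
    (ladderGraph (Order.succ μ).ord S a) (Cardinal.mk_ord_toType _).le
    (SimpleGraph.aleph0_lt_listChromaticNumber_iff.2
      (not_isListColorable_ladderGraph hSκ hScof ha g hg))
  -- The reflected subgraph has `ℵ₁ ≤ μ < cof μ⁺` vertices, so the local coloring applies.
  refine SimpleGraph.aleph0_lt_listChromaticNumber_iff.1 hlist
    (isListColorable_coe_subgraph_ladderGraph hScof ha ?_ hnrefl Y ?_)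
  · rw [hreg]
    exact hμ₀.trans (Order.le_succ μ)
  · rw [hY, hreg]
    exact Order.lt_succ_of_le hμ
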